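/- Private information delivery with $K\ge 2$ messages, $N$ servers and $M=2$ messages stored per server. Fix a finite field $\mathbb F$. A scheme consists of the following. Each message $W_1,\dots,W_K$ is a vector of $L\ge 1$ i.i.d. uniform symbols of $\mathbb F$, and the messages are independent. Server $n\in\{1,\dots,N\}$ stores the messages $W_j$, $j\in\mathcal S_n$, for a chosen set $\mathcal S_n\subseteq\{1,\dots,K\}$ with $|\mathcal S_n|=2$. The servers share a random variable $Z$ independent of $(W_1,\dots,W_K)$, of arbitrary size. To deliver message $k$, server $n$ sends to the user an answer $A_n^{[k]}\in\mathbb F^{D_n}$, which is a function of $(W_j)_{j\in\mathcal S_n}$ and $Z$; the length $D_n$ does not depend on $k$. For every $k$ the message $W_k$ has to be a function of $(A_1^{[k]},\dots,A_N^{[k]})$ (zero-error decoding), and the joint distribution of $(A_1^{[k]},\dots,A_N^{[k]},W_k)$ must be the same for all $k$ (privacy). The rate of the scheme is $L/\sum_{n=1}^N D_n$, a rate $R$ is achievable if some scheme has rate at least $R$, and the capacity $C$ is the supremum of the achievable rates over all storage designs $(\mathcal S_n)$ and all schemes ($C=0$ if there is no scheme). Then, for every finite field $\mathbb F$, $$C=\begin{cases}2/K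 & \text{if } N\ge\lceil K/2\rceil+1,\\[2pt] 1/\lceil K/2\rceil & \text{if } N=\lceil K/2\rceil,\\[2pt] 0 & \text{if } N<\lceil K/2\rceil.\end{cases}$$ -/

import Mathlib

open MeasureTheory ProbabilityTheory
open scoped ENNReal

universe u

/-- A private information delivery (PID) scheme with `K` messages, `N` servers and `M` of the
messages replicated at each server, all symbols being taken from the finite field `F`
(whose σ-algebra is the discrete one). All random variables live on one probability space `Ω`. -/
structure PIDScheme (F : Type u) [Field F] [Fintype F] [MeasurableSpace F]
    [MeasurableSingletonClass F] (K N M : ℕ) where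
  /-- number of symbols of each message -/
  L : ℕ
  L_pos : 0 < L
  /-- `S n` is the set of indices of the messages stored at server `n` -/
  S : Fin N → Finset (Fin K)
  card_S : ∀ n, (S n).card = M
  /-- `D n` is the number of symbols sent by server `n` to the user -/
  D : Fin N → ℕ
  Ω : Type u
  [measurableSpaceΩ : MeasurableSpace Ω]
  P : Measure Ω
  [isProbabilityMeasure : IsProbabilityMeasure P]
  /-- the messages, each a vector of `L` symbols -/
  W : Fin K → Ω → (Fin L → F)
  measurable_W : ∀ k, Measurable (W k)
  /-- every symbol of every message is uniform -/
  uniform_W : ∀ k i a, P {ω | W k ω i = a} = (Fintype.card F : ℝ≥0∞)⁻¹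
  /-- the symbols of each message are independent -/
  indep_symbols : ∀ k, iIndepFun (fun i ω => W k ω i) P
  /-- the messages are independent -/
  indep_messages : iIndepFun W P
  /-- the alphabet of the common randomness -/
  𝒵 : Type u
  [measurableSpaceZ : MeasurableSpace 𝒵]
  /-- the common randomness shared by the servers -/
  Z : Ω → 𝒵
  measurable_Z : Measurable Z
  /-- the common randomness is independent of the collection of all messages -/
  indep_Z : IndepFun (fun ω k => W k ω) Z P
  /-- `A k n` is the answer of server `n` when message `k` is to be delivered -/
  A : Fin K → (n : Fin N) → Ω → (Fin (D n) → F)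
  measurable_A : ∀ k n, Measurable (A k n)
  /-- the answer of server `n` is (almost surely) a function of the messages stored at server `n`
  and of the common randomness -/
  answer : ∀ k n, ∃ f : (S n → Fin L → F) × 𝒵 → (Fin (D n) → F), Measurable f ∧
    A k n =ᵐ[P] fun ω => f (fun j => W j ω, Z ω)
  /-- zero-error decoding: the desired message is (almost surely) a function of all answers -/
  decode : ∀ k, ∃ g : ((n : Fin N) → Fin (D n) → F) → (Fin L → F),
    W k =ᵐ[P] fun ω => g (fun n => A k n ω)
  /-- privacy: the joint law of the answers and the desired message does not depend on which
  message is delivered -/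
  privacy : ∀ k k', IdentDistrib (fun ω => ((fun n => A k n ω), W k ω))
    (fun ω => ((fun n => A k' n ω), W k' ω)) P P

namespace PIDScheme

variable {F : Type u} [Field F] [Fintype F] [MeasurableSpace F] [MeasurableSingletonClass F]
  {K N M : ℕ}

/-- The rate of a scheme: message symbols delivered per symbol of total download. -/
noncomputable def rate (s : PIDScheme F K N M) : ℝ≥0∞ :=
  (s.L : ℝ≥0∞) / ((∑ n, s.D n : ℕ) : ℝ≥0∞)

end PIDScheme

/-- The rate `R` is achievable if some scheme has rate at least `R`. -/
def PIDAchievable (F : Type u) [Field F] [Fintype F] [MeasurableSpace F]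
    [MeasurableSingletonClass F] (K N M : ℕ) (R : ℝ≥0∞) : Prop :=
  ∃ s : PIDScheme F K N M, R ≤ s.rate

/-- The capacity: the supremum of the achievable rates over all storage designs and all schemes.
It is taken in `[0, ∞]`, so it is `0` when there is no scheme at all. -/
noncomputable def pidCapacity (F : Type u) [Field F] [Fintype F] [MeasurableSpace F]
    [MeasurableSingletonClass F] (K N M : ℕ) : ℝ≥0∞ :=
  sSup {R | PIDAchievable F K N M R}

/-!
Converse: fixing a typical value of `Z` makes the scheme deterministic, and varying only `W k` shows
that the servers storing message `k` send at least `L` symbols together. Summing over `k` gives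
`K * L ≤ M * ∑ n, D n`. If moreover `M * N < K + M`, counting storage slots shows that every server
stores some message that no other server has, so each server sends at least `L` symbols.

Achievability: give server `n` a list of vectors of `F ^ L`, one per transmitted symbol, and let the
user add up the received symbols times these vectors. If for each `k` the vectors of the servers
storing message `k` span `F ^ L`, those servers can correct a common uniform mask so that it decodes
to `W k`. The corrected mask is the image of a uniform variable under a surjective homomorphism,
hence uniform whatever `k` is, and privacy follows. For `2 / K`, pairs of messages stored
on one server each are combined, when `K` is odd, with a triangle: three messages, each two of them
on a common server, the servers having the vectors `e₁`, `e₂` and `e₁ + e₂`.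
-/

section UniformLaw

theorem eq_uniformOn_univ {α : Type*} [Finite α] [MeasurableSpace α] [MeasurableSingletonClass α]
    {μ : Measure α} [IsProbabilityMeasure μ] (h : ∀ x y, μ {x} = μ {y}) :
    μ = uniformOn Set.univ := by
  have := Fintype.ofFinite α
  refine Measure.ext_of_singleton fun x => ?_
  have hsum : Fintype.card α * μ {x} = 1 := by
    rw [← measure_univ (μ := μ), ← Finset.coe_univ, ← sum_measure_singleton,
      Finset.sum_congr rfl fun y _ => h y x, Finset.sum_const, Finset.card_univ, nsmul_eq_mul]
  rw [uniformOn_univ, Measure.count_singleton, one_div]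
  exact ENNReal.eq_inv_of_mul_eq_one_left ((mul_comm _ _).trans hsum)

theorem uniformOn_univ_singleton {α : Type*} [Fintype α] [MeasurableSpace α]
    [MeasurableSingletonClass α] (x : α) :
    uniformOn Set.univ {x} = (Fintype.card α : ℝ≥0∞)⁻¹ := by
  rw [uniformOn_univ, Measure.count_singleton, one_div]

theorem uniformOn_univ_prod {α β : Type*} [Finite α] [Nonempty α] [Finite β] [Nonempty β]
    [MeasurableSpace α] [MeasurableSingletonClass α] [MeasurableSpace β]
    [MeasurableSingletonClass β] :
    (uniformOn Set.univ : Measure (α × β)) = (uniformOn Set.univ).prod (uniformOn Set.univ) := by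
  have := Fintype.ofFinite α
  have := Fintype.ofFinite β
  refine (eq_uniformOn_univ fun x y => ?_).symm
  simp only [← Set.singleton_prod_singleton (a := Prod.fst _), Measure.prod_prod,
    uniformOn_univ_singleton]

theorem uniformOn_univ_pi {ι α : Type*} [Fintype ι] [Finite α] [MeasurableSpace α]
    [MeasurableSingletonClass α] :
    (uniformOn Set.univ : Measure (ι → α)) = Measure.pi fun _ => uniformOn Set.univ := by
  rw [← uniformOn_pi, Set.pi_univ]

theorem measurePreserving_uniformOn_univ {G H : Type*} [AddGroup G] [AddGroup H] [Finite G]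
    [Finite H] [MeasurableSpace G] [MeasurableSingletonClass G] [MeasurableSpace H]
    [MeasurableSingletonClass H] (f : G →+ H) (hf : Function.Surjective f) :
    MeasurePreserving f (uniformOn Set.univ) (uniformOn Set.univ) := by
  classical
  have := Fintype.ofFinite G
  have hmeas : Measurable f := .of_discrete
  have := Measure.isProbabilityMeasure_map (μ := uniformOn (Set.univ : Set G)) hmeas.aemeasurable
  refine ⟨hmeas, eq_uniformOn_univ fun x y => ?_⟩
  have hfiber (z : H) : f ⁻¹' {z} = ({a | f a = z} : Finset G) := by ext; simp
  simp only [Measure.map_apply hmeas (measurableSet_singleton _), uniformOn_univ, hfiber,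
    Measure.count_apply_finset,
    AddMonoidHom.card_fiber_eq_of_mem_range f (hf x) (hf y)]

theorem iIndepFun_of_hasLaw_pi {ι Ω : Type*} [Fintype ι] [MeasurableSpace Ω] {P : Measure Ω}
    [IsProbabilityMeasure P] {α : ι → Type*} [∀ i, MeasurableSpace (α i)]
    {μ : ∀ i, Measure (α i)} [∀ i, IsProbabilityMeasure (μ i)] {X : ∀ i, Ω → α i}
    (h : HasLaw (fun ω i => X i ω) (Measure.pi μ) P) : iIndepFun X P :=
  (iIndepFun_iff_hasLaw_pi_pi fun i => (measurePreserving_eval μ i).fun_comp_hasLaw h).2 h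

theorem hasLaw_fst_pi {ι α β : Type*} [Fintype ι] [Finite α] [Nonempty α] [MeasurableSpace α]
    [MeasurableSingletonClass α] [Finite β] [Nonempty β] [MeasurableSpace β]
    [MeasurableSingletonClass β] :
    HasLaw (fun ω : (ι → α) × β => fun i => ω.1 i) (Measure.pi fun _ => uniformOn Set.univ)
      (uniformOn Set.univ) := by
  rw [uniformOn_univ_prod, ← uniformOn_univ_pi]
  exact measurePreserving_fst.hasLaw

theorem hasLaw_fst_apply_pi {ι κ α β : Type*} [Finite ι] [Fintype κ] [Finite α] [Nonempty α]
    [MeasurableSpace α] [MeasurableSingletonClass α] [Finite β] [Nonempty β] [MeasurableSpace β]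
    [MeasurableSingletonClass β] (i : ι) :
    HasLaw (fun ω : (ι → κ → α) × β => fun j => ω.1 i j)
      (Measure.pi fun _ => uniformOn Set.univ) (uniformOn Set.univ) := by
  have := Fintype.ofFinite ι
  rw [← uniformOn_univ_pi]
  exact (measurePreserving_eval _ i).fun_comp_hasLaw hasLaw_fst_pi

end UniformLaw

theorem ae_of_indepFun {Ω α β : Type*} [MeasurableSpace Ω] [MeasurableSpace α]
    [MeasurableSingletonClass α] [MeasurableSpace β] {P : Measure Ω} {X : Ω → α} {Y : Ω → β}
    (hXY : IndepFun X Y P) {p : α → β → Prop} {x : α} (hx : P (X ⁻¹' {x}) ≠ 0)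
    (hp : MeasurableSet {y | p x y}) (h : ∀ᵐ ω ∂P, p (X ω) (Y ω)) : ∀ᵐ ω ∂P, p x (Y ω) := by
  have hnull : P (X ⁻¹' {x} ∩ Y ⁻¹' {y | p x y}ᶜ) = 0 := by
    refine measure_mono_null ?_ (ae_iff.1 h)
    rintro ω ⟨rfl, hω⟩
    exact hω
  rw [hXY.measure_inter_preimage_eq_mul _ _ (measurableSet_singleton x) hp.compl] at hnull
  exact ae_iff.2 ((mul_eq_zero.1 hnull).resolve_left hx)

namespace PIDScheme

attribute [instance] measurableSpaceΩ isProbabilityMeasure measurableSpaceZ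

variable {F : Type u} [Field F] [Fintype F] [MeasurableSpace F] [MeasurableSingletonClass F]
  {K N M : ℕ}

theorem hasLaw_messages (s : PIDScheme F K N M) :
    HasLaw (fun ω k => s.W k ω) (uniformOn Set.univ) s.P := by
  have hsymbol (k : Fin K) (i : Fin s.L) :
      HasLaw (fun ω => s.W k ω i) (uniformOn Set.univ) s.P := by
    have hmeas : Measurable fun ω => s.W k ω i := (measurable_pi_apply i).comp (s.measurable_W k)
    refine ⟨hmeas.aemeasurable, Measure.ext_of_singleton fun a => ?_⟩
    rw [Measure.map_apply hmeas (measurableSet_singleton a), uniformOn_univ_singleton]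
    exact s.uniform_W k i a
  have hmessage (k : Fin K) : HasLaw (s.W k) (uniformOn Set.univ) s.P := by
    rw [uniformOn_univ_pi]
    exact (s.indep_symbols k).hasLaw_pi (hsymbol k)
  rw [uniformOn_univ_pi]
  exact s.indep_messages.hasLaw_pi hmessage

theorem measure_messages_ne_zero (s : PIDScheme F K N M) (w : Fin K → Fin s.L → F) :
    s.P ((fun ω k => s.W k ω) ⁻¹' {w}) ≠ 0 := by
  rw [← Measure.map_apply_of_aemeasurable s.hasLaw_messages.aemeasurable
    (measurableSet_singleton w), s.hasLaw_messages.map_eq, uniformOn_univ_singleton]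
  exact ENNReal.inv_ne_zero.2 (ENNReal.natCast_ne_top _)

theorem exists_deterministic_decoding (s : PIDScheme F K N M) (k : Fin K) :
    ∃ (f : ∀ n, (s.S n → Fin s.L → F) → (Fin (s.D n) → F))
      (g : (∀ n, Fin (s.D n) → F) → (Fin s.L → F)),
      ∀ w : Fin K → Fin s.L → F, w k = g fun n => f n fun j => w j := by
  choose f hf hA using s.answer k
  obtain ⟨g, hg⟩ := s.decode k
  have hdecode : ∀ᵐ ω ∂s.P, s.W k ω = g fun n => f n (fun j => s.W j ω, s.Z ω) := by
    filter_upwards [hg, ae_all_iff.2 hA] with ω hW hAω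
    rw [hW, funext hAω]
  have hfixed (w : Fin K → Fin s.L → F) :
      ∀ᵐ ω ∂s.P, w k = g fun n => f n (fun j => w j, s.Z ω) := by
    refine ae_of_indepFun (p := fun w z => w k = g fun n => f n (fun j => w j, z)) s.indep_Z
      (s.measure_messages_ne_zero w) (measurableSet_eq_fun measurable_const ?_) hdecode
    exact (Measurable.of_discrete (f := g)).comp (measurable_pi_lambda _ fun n =>
      (hf n).comp (measurable_const.prodMk measurable_id))
  obtain ⟨ω, hω⟩ := (ae_all_iff.2 hfixed).exists
  exact ⟨fun n x => f n (x, s.Z ω), g, hω⟩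

theorem length_le_sum_storing (s : PIDScheme F K N M) (k : Fin K) :
    s.L ≤ ∑ n with k ∈ s.S n, s.D n := by
  obtain ⟨f, g, hfg⟩ := s.exists_deterministic_decoding k
  let T : Finset (Fin N) := {n | k ∈ s.S n}
  let messages (x : Fin s.L → F) : Fin K → Fin s.L → F := Function.update 0 k x
  let answers (x : Fin s.L → F) (n : T) : Fin (s.D n) → F := f n fun j => messages x j
  have hother (x y : Fin s.L → F) (n : Fin N) (hn : k ∉ s.S n) :
      f n (fun j => messages x j) = f n fun j => messages y j := by
    congr 1
    funext j
    have hj : (j : Fin K) ≠ k := fun h => hn (h ▸ j.2)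
    simp only [messages, Function.update_of_ne hj]
  have hinj : Function.Injective answers := by
    intro x y hxy
    have hall : (fun n => f n fun j => messages x j) = fun n => f n fun j => messages y j := by
      funext n
      by_cases hn : k ∈ s.S n
      · exact congrFun hxy ⟨n, by simp [T, hn]⟩
      · exact hother x y n hn
    have hk : messages x k = messages y k := by rw [hfg (messages x), hfg (messages y), hall]
    simpa only [messages, Function.update_self] using hk
  have hcard := Fintype.card_le_of_injective answers hinj
  simp only [Fintype.card_pi, Finset.prod_const, Finset.card_univ, Fintype.card_fin,
    Finset.prod_pow_eq_pow_sum] at hcard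
  rw [← Finset.sum_coe_sort T s.D]
  exact (Nat.pow_le_pow_iff_right Fintype.one_lt_card).1 hcard

theorem sum_sum_storing (s : PIDScheme F K N M) (x : Fin N → ℕ) :
    ∑ k, ∑ n with k ∈ s.S n, x n = M * ∑ n, x n := by
  rw [Finset.sum_comm' (t' := Finset.univ) (s' := s.S) (by simp), Finset.mul_sum]
  simp only [Finset.sum_const, s.card_S, smul_eq_mul]

theorem sum_card_storing (s : PIDScheme F K N M) :
    ∑ k, Finset.card {n | k ∈ s.S n} = M * N := by
  simpa using s.sum_sum_storing fun _ => 1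

theorem card_storing_pos (s : PIDScheme F K N M) (k : Fin K) :
    0 < Finset.card {n | k ∈ s.S n} := by
  rw [Finset.card_pos]
  by_contra! hempty
  have hle := s.length_le_sum_storing k
  rw [hempty, Finset.sum_empty] at hle
  exact hle.not_gt s.L_pos

theorem messages_le_storage (s : PIDScheme F K N M) : K ≤ M * N := by
  simpa [s.sum_card_storing] using
    Finset.sum_le_sum fun k (_ : k ∈ Finset.univ) => Nat.one_le_of_lt (s.card_storing_pos k)

theorem messages_mul_length_le (s : PIDScheme F K N M) : K * s.L ≤ M * ∑ n, s.D n := by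
  simpa [s.sum_sum_storing] using
    Finset.sum_le_sum fun k (_ : k ∈ Finset.univ) => s.length_le_sum_storing k

theorem exists_storing_eq_singleton (s : PIDScheme F K N M) (h : M * N < K + M) (n : Fin N) :
    ∃ k, ({n' | k ∈ s.S n'} : Finset (Fin N)) = {n} := by
  by_contra! hshared
  have htwo (k : Fin K) : 1 + (if k ∈ s.S n then 1 else 0) ≤ Finset.card {n' | k ∈ s.S n'} := by
    split_ifs with hk
    · by_contra! hlt
      have hn : n ∈ ({n' | k ∈ s.S n'} : Finset (Fin N)) := by simpa
      exact hshared k (Finset.eq_singleton_iff_unique_mem.2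
        ⟨hn, fun _ hy => Finset.card_le_one.1 (Nat.le_of_lt_succ hlt) _ hy _ hn⟩)
    · exact s.card_storing_pos k
  have hle : K + M ≤ M * N := by
    simpa [s.sum_card_storing, Finset.sum_add_distrib, s.card_S] using
      Finset.sum_le_sum fun k (_ : k ∈ Finset.univ) => htwo k
  exact h.not_ge hle

theorem servers_mul_length_le (s : PIDScheme F K N M) (h : M * N < K + M) :
    N * s.L ≤ ∑ n, s.D n := by
  have hserver (n : Fin N) : s.L ≤ s.D n := by
    obtain ⟨k, hk⟩ := s.exists_storing_eq_singleton h n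
    simpa [hk] using s.length_le_sum_storing k
  simpa using Finset.sum_le_sum fun n (_ : n ∈ Finset.univ) => hserver n

theorem rate_le_div (s : PIDScheme F K N M) {a b : ℕ} (ha : 0 < a)
    (h : a * s.L ≤ b * ∑ n, s.D n) : s.rate ≤ b / a := by
  have hD : 0 < ∑ n, s.D n := Nat.pos_of_mul_pos_left ((Nat.mul_pos ha s.L_pos).trans_le h)
  rw [rate, ENNReal.div_le_iff (by exact_mod_cast hD.ne') (ENNReal.natCast_ne_top _), mul_comm,
    ← mul_div_assoc, ENNReal.le_div_iff_mul_le (.inl (by exact_mod_cast ha.ne'))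
      (.inl (ENNReal.natCast_ne_top _))]
  exact_mod_cast (by linarith : s.L * a ≤ (∑ n, s.D n) * b)

end PIDScheme

section MaskedAnswer

variable {G H : Type*} [AddCommGroup G] [AddCommGroup H]

/-- The answers delivering the message `w` with the mask `z`, as a homomorphism in `(w, z)`: the
section `t` of the decoder `g` corrects the value that `z` decodes to from `g z` to `w`. -/
def maskedAnswer (g : H →+ G) (t : G →+ H) : G × H →+ H :=
  .snd G H + t.comp (.fst G H - g.comp (.snd G H))

theorem maskedAnswer_apply (g : H →+ G) (t : G →+ H) (w : G) (z : H) :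
    maskedAnswer g t (w, z) = z + t (w - g z) :=
  rfl

theorem decode_maskedAnswer {g : H →+ G} {t : G →+ H} (ht : Function.RightInverse t g) (w : G)
    (z : H) : g (maskedAnswer g t (w, z)) = w := by
  rw [maskedAnswer_apply, map_add, ht, add_sub_cancel]

theorem maskedAnswer_surjective (g : H →+ G) (t : G →+ H) :
    Function.Surjective (maskedAnswer g t) :=
  fun a => ⟨(g a, a), by simp [maskedAnswer_apply]⟩

theorem hasLaw_maskedAnswer {ι : Type*} [Finite ι] [Finite G] [MeasurableSpace G]
    [MeasurableSingletonClass G] [Finite H] [MeasurableSpace H] [MeasurableSingletonClass H]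
    (g : H →+ G) (t : G →+ H) (k : ι) :
    HasLaw (fun ω : (ι → G) × H => maskedAnswer g t (ω.1 k, ω.2)) (uniformOn Set.univ)
      (uniformOn Set.univ) := by
  let f := (maskedAnswer g t).comp ((Pi.evalAddMonoidHom (fun _ : ι => G) k).prodMap (.id H))
  refine (measurePreserving_uniformOn_univ f ?_).hasLaw
  exact (maskedAnswer_surjective g t).comp
    ((Function.surjective_eval k).prodMap Function.surjective_id)

end MaskedAnswer

section MaskedScheme

variable {F : Type u} [Field F] [Fintype F] [MeasurableSpace F] [MeasurableSingletonClass F]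
  {K N M L : ℕ} {D : Fin N → ℕ}

/-- The scheme whose common randomness is a uniform mask on all answers; message `k` is delivered by
correcting the mask with the section `t k` of the decoder `g`, which only changes the answers of the
servers storing message `k`. -/
noncomputable def maskedScheme (hL : 0 < L) (S : Fin N → Finset (Fin K))
    (hS : ∀ n, (S n).card = M) (g : (∀ n, Fin (D n) → F) →+ (Fin L → F))
    (t : Fin K → (Fin L → F) →+ ∀ n, Fin (D n) → F) (ht : ∀ k, Function.RightInverse (t k) g)
    (hsupp : ∀ k w n, k ∉ S n → t k w n = 0) : PIDScheme F K N M where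
  L := L
  L_pos := hL
  S := S
  card_S := hS
  D := D
  Ω := (Fin K → Fin L → F) × ∀ n, Fin (D n) → F
  P := uniformOn Set.univ
  W k ω := ω.1 k
  measurable_W _ := .of_discrete
  uniform_W k i a := by
    rw [← uniformOn_univ_singleton a]
    exact ((measurePreserving_eval _ i).fun_comp_hasLaw (hasLaw_fst_apply_pi k)).measure_eq
      (measurableSet_singleton a)
  indep_symbols k := iIndepFun_of_hasLaw_pi (hasLaw_fst_apply_pi k)
  indep_messages := iIndepFun_of_hasLaw_pi hasLaw_fst_pi
  𝒵 := ∀ n, Fin (D n) → F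
  Z ω := ω.2
  measurable_Z := measurable_snd
  indep_Z := by
    rw [uniformOn_univ_prod]
    exact indepFun_prod measurable_id measurable_id
  A k n ω := maskedAnswer g (t k) (ω.1 k, ω.2) n
  measurable_A _ _ := .of_discrete
  answer k n := by
    refine ⟨fun x => if h : k ∈ S n then maskedAnswer g (t k) (x.1 ⟨k, h⟩, x.2) n else x.2 n,
      .of_discrete, .of_forall fun ω => ?_⟩
    by_cases h : k ∈ S n
    · simp only [dif_pos h]
    · simp [h, maskedAnswer_apply, hsupp k _ n h]
  decode k := ⟨g, .of_forall fun ω => (decode_maskedAnswer (ht k) _ _).symm⟩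
  privacy k k' := by
    have h := ((hasLaw_maskedAnswer g (t k) k).identDistrib (hasLaw_maskedAnswer g (t k') k')).comp
      (u := fun a => (a, g a)) .of_discrete
    simpa only [Function.comp_def, decode_maskedAnswer (ht _)] using h

end MaskedScheme

section SpanningDesign

/-- A linear scheme in outline: `S n` is the set of `M` messages at server `n`, and every vector of
the list `c n` stands for one symbol sent by server `n`, which the decoder multiplies by that
vector. For each message the vectors of the servers storing it span the space `F ^ L` of message
values, and `T` is the total number of symbols sent. -/
def HasSpanningDesign (F : Type*) [Field F] (K N M L T : ℕ) : Prop :=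
  ∃ (S : Fin N → Finset (Fin K)) (c : Fin N → List (Fin L → F)), (∀ n, (S n).card = M) ∧
    (∀ k, Submodule.span F {v | ∃ n, k ∈ S n ∧ v ∈ c n} = ⊤) ∧ ∑ n, (c n).length = T

variable {F : Type u} [Field F] {K N M L T : ℕ}

section Decoder

variable {ι V : Type*} [Fintype ι] [DecidableEq ι] [AddCommGroup V] [Module F V]

/-- The decoder of a linear scheme: the linear combination of the received symbols with
the vectors listed by `c`. -/
def listDecoder (c : ι → List V) : (∀ n, Fin (c n).length → F) →ₗ[F] V :=
  LinearMap.lsum F _ F fun n => Fintype.linearCombination F (c n).get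

theorem listDecoder_single (c : ι → List V) (n : ι) (i : Fin (c n).length) :
    listDecoder c (Pi.single n (Pi.single i (1 : F))) = (c n).get i := by
  simp only [listDecoder, LinearMap.lsum_piSingle, Fintype.linearCombination_apply_single, one_smul]

theorem exists_supported_section {p : ι → Prop} {c : ι → List V}
    (h : Submodule.span F {v | ∃ n, p n ∧ v ∈ c n} = ⊤) :
    ∃ t : V →ₗ[F] ∀ n, Fin (c n).length → F,
      Function.RightInverse t (listDecoder c) ∧ ∀ w n, ¬ p n → t w n = 0 := by
  let U : Submodule F (∀ n, Fin (c n).length → F) := Submodule.pi {n | ¬ p n} fun _ => ⊥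
  have hsurj : LinearMap.range ((listDecoder c).domRestrict U) = ⊤ := by
    rw [eq_top_iff, ← h, Submodule.span_le]
    rintro v ⟨n, hn, hv⟩
    obtain ⟨i, rfl⟩ := List.get_of_mem hv
    refine ⟨⟨Pi.single n (Pi.single i 1), fun m hm => ?_⟩, listDecoder_single c n i⟩
    exact Pi.single_eq_of_ne (by rintro rfl; exact hm hn) _
  obtain ⟨t, ht⟩ := LinearMap.exists_rightInverse_of_surjective _ hsurj
  exact ⟨U.subtype ∘ₗ t, LinearMap.congr_fun ht, fun w n hn => (t w).2 n hn⟩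

end Decoder

theorem HasSpanningDesign.pidAchievable [Fintype F] [MeasurableSpace F]
    [MeasurableSingletonClass F] (h : HasSpanningDesign F K N M L T) (hL : 0 < L) :
    PIDAchievable F K N M (L / T) := by
  obtain ⟨S, c, hS, hspan, rfl⟩ := h
  choose t ht hsupp using fun k => exists_supported_section (hspan k)
  exact ⟨maskedScheme hL S hS (listDecoder c).toAddMonoidHom (fun k => (t k).toAddMonoidHom) ht
    hsupp, le_rfl⟩

theorem hasSpanningDesign_empty : HasSpanningDesign F 0 0 M L 0 :=
  ⟨Fin.elim0, Fin.elim0, fun n => n.elim0, fun k => k.elim0, rfl⟩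

theorem HasSpanningDesign.add_idle_server (h : HasSpanningDesign F K N M L T) (hMK : M ≤ K) :
    HasSpanningDesign F K (N + 1) M L T := by
  obtain ⟨S, c, hS, hspan, hT⟩ := h
  obtain ⟨B, -, hB⟩ := Finset.exists_subset_card_eq (s := (Finset.univ : Finset (Fin K)))
    (n := M) (by simpa)
  refine ⟨Fin.cons B S, Fin.cons [] c, Fin.cases hB hS, fun k => ?_,
    by simp [Fin.sum_univ_succ, hT]⟩
  refine top_le_iff.1 ((hspan k).ge.trans (Submodule.span_mono ?_))
  rintro v ⟨n, hn⟩
  exact ⟨n.succ, hn⟩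

theorem HasSpanningDesign.mono_servers {N' : ℕ} (h : HasSpanningDesign F K N M L T) (hMK : M ≤ K)
    (hN : N ≤ N') : HasSpanningDesign F K N' M L T := by
  induction N', hN using Nat.le_induction with
  | base => exact h
  | succ n _ ih => exact ih.add_idle_server hMK

theorem HasSpanningDesign.add_block (h : HasSpanningDesign F K N M L T) :
    HasSpanningDesign F (K + M) (N + 1) M L (L + T) := by
  obtain ⟨S, c, hS, hspan, hT⟩ := h
  let basis : List (Fin L → F) := List.ofFn (Pi.basisFun F (Fin L))
  refine ⟨Fin.cons (Finset.univ.map (Fin.natAddEmb K)) fun n => (S n).map (Fin.castAddEmb M),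
    Fin.cons basis c, Fin.cases (by simp) (by simpa), Fin.addCases (fun k => ?_) (fun k => ?_),
    by simp [Fin.sum_univ_succ, hT, basis]⟩
  · refine top_le_iff.1 ((hspan k).ge.trans (Submodule.span_mono ?_))
    rintro v ⟨n, hk, hv⟩
    exact ⟨n.succ, by simpa using hk, hv⟩
  · refine top_le_iff.1 ((Pi.basisFun F (Fin L)).span_eq.ge.trans (Submodule.span_mono ?_))
    rintro v ⟨i, rfl⟩
    exact ⟨0, by simp, List.mem_ofFn.2 ⟨i, rfl⟩⟩

theorem HasSpanningDesign.add_blocks (h : HasSpanningDesign F K N M L T) (j : ℕ) :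
    HasSpanningDesign F (K + j * M) (N + j) M L (j * L + T) := by
  induction j with
  | zero => simpa
  | succ j ih => convert ih.add_block using 1 <;> ring

theorem exists_cover_card_eq (hMK : M ≤ K) (hKN : K ≤ M * N) :
    ∃ S : Fin N → Finset (Fin K), (∀ n, (S n).card = M) ∧ ∀ k, ∃ n, k ∈ S n := by
  let block (n : Fin N) : Finset (Fin K) := {k | k.val ∈ Finset.Ico (n * M) (n * M + M)}
  have hblock (n : Fin N) : (block n).card ≤ M := by
    have h := Finset.card_le_card_of_injOn (s := block n) (t := Finset.Ico (n * M) (n * M + M))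
      Fin.val (fun k hk => (Finset.mem_filter.1 hk).2) Fin.val_injective.injOn
    simpa using h
  choose S hS hcard using fun n => Finset.exists_superset_card_eq (hblock n) (by simpa)
  refine ⟨S, hcard, fun k => ?_⟩
  have hM : 0 < M := Nat.pos_of_mul_pos_right (k.pos.trans_le hKN)
  have hk : k.val / M < N := Nat.div_lt_of_lt_mul (k.2.trans_le hKN)
  refine ⟨⟨k / M, hk⟩, hS _ (Finset.mem_filter.2 ⟨Finset.mem_univ k, Finset.mem_Ico.2 ?_⟩)⟩
  exact ⟨Nat.div_mul_le_self k M, Nat.lt_div_mul_add hM⟩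

theorem hasSpanningDesign_one (hMK : M ≤ K) (hKN : K ≤ M * N) :
    HasSpanningDesign F K N M 1 N := by
  obtain ⟨S, hS, hcover⟩ := exists_cover_card_eq hMK hKN
  refine ⟨S, fun _ => [Pi.basisFun F (Fin 1) 0], hS, fun k => ?_, by simp⟩
  obtain ⟨n, hn⟩ := hcover k
  rw [eq_top_iff, ← (Pi.basisFun F (Fin 1)).span_eq]
  refine Submodule.span_mono ?_
  rintro v ⟨i, rfl⟩
  exact ⟨n, hn, by rw [Subsingleton.elim i 0]; exact List.mem_singleton_self _⟩

theorem eq_top_of_mem_fin_two {U : Submodule F (Fin 2 → F)} (h₀ : ![1, 0] ∈ U) (h₁ : ![0, 1] ∈ U) :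
    U = ⊤ := by
  refine (Submodule.eq_top_iff'.2 fun v => ?_)
  have hv : v = v 0 • ![1, 0] + v 1 • ![0, 1] := by
    ext i
    fin_cases i <;> simp
  exact hv ▸ U.add_mem (U.smul_mem _ h₀) (U.smul_mem _ h₁)

theorem hasSpanningDesign_triangle : HasSpanningDesign F 3 3 2 2 3 := by
  let S : Fin 3 → Finset (Fin 3) := ![{0, 1}, {1, 2}, {0, 2}]
  let c : Fin 3 → List (Fin 2 → F) := ![[![1, 0]], [![0, 1]], [![1, 1]]]
  have hmem (k n : Fin 3) (v : Fin 2 → F) (hk : k ∈ S n) (hv : v ∈ c n) :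
      v ∈ Submodule.span F {v | ∃ n, k ∈ S n ∧ v ∈ c n} :=
    Submodule.subset_span ⟨n, hk, hv⟩
  refine ⟨S, c, by decide, fun k => ?_, rfl⟩
  fin_cases k
  · have h₀ := hmem 0 0 ![1, 0] (by decide) (by simp [c])
    have h₂ := hmem 0 2 ![1, 1] (by decide) (by simp [c])
    exact eq_top_of_mem_fin_two h₀ (by simpa using Submodule.sub_mem _ h₂ h₀)
  · exact eq_top_of_mem_fin_two (hmem 1 0 ![1, 0] (by decide) (by simp [c]))
      (hmem 1 1 ![0, 1] (by decide) (by simp [c]))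
  · have h₁ := hmem 2 1 ![0, 1] (by decide) (by simp [c])
    have h₂ := hmem 2 2 ![1, 1] (by decide) (by simp [c])
    have hsub : (![1, 0] : Fin 2 → F) = ![1, 1] - ![0, 1] := by
      ext i
      fin_cases i <;> simp
    exact eq_top_of_mem_fin_two (hsub ▸ Submodule.sub_mem _ h₂ h₁) h₁

theorem hasSpanningDesign_two (hK : 2 ≤ K) (hN : (K + 1) / 2 + 1 ≤ N) :
    HasSpanningDesign F K N 2 2 K := by
  obtain ⟨j, rfl | rfl⟩ : ∃ j, K = j * 2 ∨ K = j * 2 + 3 := ⟨(K - 3 * (K % 2)) / 2, by omega⟩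
  · have h := (hasSpanningDesign_empty (F := F) (M := 2) (L := 2)).add_blocks j
    rw [zero_add] at h
    exact h.mono_servers hK (by omega)
  · have h := (hasSpanningDesign_triangle (F := F)).add_blocks j
    rw [add_comm 3 (j * 2)] at h
    exact h.mono_servers hK (by omega)

end SpanningDesign

section Capacity

variable {F : Type u} [Field F] [Fintype F] [MeasurableSpace F] [MeasurableSingletonClass F]
  {K N M : ℕ}

theorem pidCapacity_le {C : ℝ≥0∞} (h : ∀ s : PIDScheme F K N M, s.rate ≤ C) :
    pidCapacity F K N M ≤ C :=
  sSup_le fun _ ⟨s, hR⟩ => hR.trans (h s)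

theorem PIDAchievable.le_pidCapacity {R : ℝ≥0∞} (h : PIDAchievable F K N M R) :
    R ≤ pidCapacity F K N M :=
  le_sSup h

theorem pidCapacity_le_div (hK : 0 < K) : pidCapacity F K N M ≤ M / K :=
  pidCapacity_le fun s => s.rate_le_div hK s.messages_mul_length_le

theorem pidCapacity_eq_zero (h : M * N < K) : pidCapacity F K N M = 0 :=
  le_bot_iff.1 (pidCapacity_le fun s => absurd s.messages_le_storage h.not_ge)

theorem pidCapacity_eq_one_div (hMK : M ≤ K) (hKN : K ≤ M * N) (h : M * N < K + M) :
    pidCapacity F K N M = 1 / N := by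
  have hN : 0 < N := Nat.pos_of_ne_zero (by rintro rfl; omega)
  refine le_antisymm (pidCapacity_le fun s => ?_) ?_
  · simpa using s.rate_le_div (b := 1) hN (by simpa using s.servers_mul_length_le h)
  · simpa using ((hasSpanningDesign_one hMK hKN).pidAchievable one_pos).le_pidCapacity

theorem pidCapacity_two_eq_div (hK : 2 ≤ K) (hN : (K + 1) / 2 + 1 ≤ N) :
    pidCapacity F K N 2 = 2 / K :=
  le_antisymm (pidCapacity_le_div (by omega))
    ((hasSpanningDesign_two hK hN).pidAchievable two_pos).le_pidCapacity

end Capacity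

theorem ceil_half (K : ℕ) : ⌈(K : ℝ) / 2⌉₊ = (K + 1) / 2 := by
  refine eq_of_forall_ge_iff fun m => ?_
  have hcast : (K : ℝ) ≤ m * 2 ↔ K ≤ m * 2 := by exact_mod_cast Iff.rfl
  rw [Nat.ceil_le, div_le_iff₀ two_pos, hcast]
  omega

theorem corollary2 (F : Type*) [Field F] [Fintype F] [MeasurableSpace F]
    [MeasurableSingletonClass F] (K N : ℕ) (hK : 2 ≤ K) :
    (⌈(K : ℝ) / 2⌉₊ + 1 ≤ N → pidCapacity F K N 2 = 2 / (K : ℝ≥0∞)) ∧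
    (N = ⌈(K : ℝ) / 2⌉₊ → pidCapacity F K N 2 = 1 / (⌈(K : ℝ) / 2⌉₊ : ℝ≥0∞)) ∧
    (N < ⌈(K : ℝ) / 2⌉₊ → pidCapacity F K N 2 = 0) := by
  rw [ceil_half]
  refine ⟨pidCapacity_two_eq_div hK, ?_, fun hN => pidCapacity_eq_zero (by omega)⟩
  rintro rfl
  exact pidCapacity_eq_one_div hK (by omega) (by omega)
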